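/- **Setting.** Let $X\subset\mathbb R^d$ be compact, let $f_1,\dots,f_k:X\to\mathbb R$ be linearly independent continuous functions, $\mathcal F=\mathrm{span}\{f_1,\dots,f_k\}$, and let $K:X\times X\to\mathbb R$ be a symmetric continuous kernel that is conditionally positive definite with respect to $\mathcal F$: $\sum_{i,j=1}^n\alpha_i\alpha_jK(x_i,x_j)\ge 0$ whenever $x_1,\dots,x_n\in X$ and $\alpha\in\mathbb R^n$ satisfy $\sum_i\alpha_i p(x_i)=0$ for all $p\in\mathcal F$. Let $P$ be a Borel probability measure on $X$ that is $\mathcal F$-nondegenerate, i.e. the Gram matrix $G=[\int f_if_j\,dP]_{i,j=1}^k$ is invertible. Put $\Pi_Pg(x)=\int\sum_{i,j}(G^{-1})_{ij}f_i(x)f_j(y)g(y)\,dP(y)$ and define the residual kernel $$K_P(x,y)=K(x,y)-\Pi_P[K(x,\cdot)](y)-\Pi_P[K(\cdot,y)](x)+\Pi_P\big[x'\mapsto\Pi_P[K(x',\cdot)](y)\big](x).$$ Let $\mathcal L$ be the space of functions $\sum_{i=1}^n\alpha_iK(x_i,\cdot)$ with $\sum_i\alpha_ip(x_i)=0$ for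 all $p\in\mathcal F$, with the semi-inner product $\langle\sum_i\alpha_iK(x_i,\cdot),\sum_j\beta_jK(y_j,\cdot)\rangle_{\mathcal L}=\sum_{i,j}\alpha_i\beta_jK(x_i,y_j)$, and let $\widetilde{\mathcal H}_K^{\mathcal F}$ be its (Hausdorff) completion, a Hilbert space. A *natural embedding* is a continuous linear map $\iota:\widetilde{\mathcal H}_K^{\mathcal F}\to C(X)$ such that $\iota([u])-u\in\mathcal F$ for every $u\in\mathcal L$, where $[u]$ is the class of $u$. Given $\iota$, the native space is $\mathcal H_K^{\mathcal F}=\iota(\widetilde{\mathcal H}_K^{\mathcal F})\oplus\mathcal F$ with the semi-inner product $\langle\iota h+p,\iota h'+p'\rangle_{\mathcal H_K^{\mathcal F}}=\langle h,h'\rangle_{\widetilde{\mathcal H}_K^{\mathcal F}}$ for $h,h'\in\widetilde{\mathcal H}_K^{\mathcal F}$, $p,p'\in\mathcal F$. **Theorem.** The kernel $K_P$ is positive definite; let $\mathcal H_{K_P}$ be its reproducing kernel Hilbert space. A natural embedding exists, and for every natural embedding $\iota$ the following hold. 1. $\iota$ is injective and the sums $\iota(\widetilde{\mathcal H}_K^{\mathcal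 F})+\mathcal F$ and $\mathcal H_{K_P}+\mathcal F$ are direct, so that both semi-inner products below are well defined. 2. As spaces of functions on $X$, $\mathcal H_K^{\mathcal F}=\mathcal H_{K_P}\oplus\mathcal F$. 3. The semi-inner products agree: if $g=u+p$ and $h=v+q$ with $u,v\in\mathcal H_{K_P}$ and $p,q\in\mathcal F$, then $\langle g,h\rangle_{\mathcal H_K^{\mathcal F}}=\langle u,v\rangle_{\mathcal H_{K_P}}$. In particular $\|u+p\|_{\mathcal H_K^{\mathcal F}}=\|u\|_{\mathcal H_{K_P}}$. Thus $\mathcal H_K^{\mathcal F}$ and $\mathcal H_{K_P}\oplus\mathcal F$ coincide as semi-Hilbert spaces; in particular the native space does not depend on $\iota$. -/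

import Mathlib

open MeasureTheory
open scoped InnerProductSpace

noncomputable section

/-- `∑ᵢ αᵢ g(xᵢ)`, where `α` is a finitely supported coefficient family on the points of `X`. -/
def pointSum {X : Type*} (α : X →₀ ℝ) (g : X → ℝ) : ℝ := α.sum fun x a => a * g x

/-- The coefficient families with `∑ᵢ αᵢ p(xᵢ) = 0` for all `p ∈ F`. -/
def constraintSpace {X : Type*} (F : Submodule ℝ (X → ℝ)) : Submodule ℝ (X →₀ ℝ) where
  carrier := {α | ∀ p ∈ F, pointSum α p = 0}
  zero_mem' := by intro p _; simp [pointSum]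
  add_mem' := by
    intro a b ha hb p hp
    have h : pointSum (a + b) p = pointSum a p + pointSum b p :=
      Finsupp.sum_add_index' (by simp) (by intros; ring)
    rw [h, ha p hp, hb p hp, add_zero]
  smul_mem' := by
    intro c a ha p hp
    have h : pointSum (c • a) p = c * pointSum a p := by
      unfold pointSum
      rw [Finsupp.sum_smul_index (by simp), Finsupp.mul_sum]
      simp [mul_assoc]
    rw [h, ha p hp, mul_zero]

/-- A symmetric continuous kernel on `X` that is conditionally positive definite with respect
to the function space `F`. -/
structure CPDKernel {X : Type*} [TopologicalSpace X] (F : Submodule ℝ (X → ℝ)) where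
  /-- The kernel function. -/
  toFun : X → X → ℝ
  symm : ∀ x y, toFun x y = toFun y x
  continuous : Continuous fun z : X × X => toFun z.1 z.2
  cpd : ∀ (n : ℕ) (x : Fin n → X) (α : Fin n → ℝ),
    (∀ p ∈ F, ∑ i, α i * p (x i) = 0) →
      0 ≤ ∑ i, ∑ j, α i * α j * toFun (x i) (x j)

namespace CPDKernel

variable {X : Type*} [TopologicalSpace X] {F : Submodule ℝ (X → ℝ)} (K : CPDKernel F)

/-- `α ↦ ∑ᵢ αᵢ K(xᵢ, ·)`. -/
def comb : (X →₀ ℝ) →ₗ[ℝ] (X → ℝ) := Finsupp.linearCombination ℝ K.toFun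

/-- The quadratic form data `∑ᵢ ∑ⱼ αᵢ βⱼ K(xᵢ, yⱼ)`. -/
def form (α β : X →₀ ℝ) : ℝ := α.sum fun x a => β.sum fun y b => a * b * K.toFun x y

/-- The function space `L = {∑ᵢ αᵢ K(xᵢ, ·) | ∑ᵢ αᵢ p(xᵢ) = 0 for all p ∈ F}`. -/
def constrainedSpan : Submodule ℝ (X → ℝ) := (constraintSpace F).map K.comb

/-- A copy of `constrainedSpan`, to carry the (semi-)inner product of the kernel instead of the
topology of pointwise convergence. -/
def PreNative : Type _ := K.constrainedSpan

instance : AddCommGroup K.PreNative := inferInstanceAs (AddCommGroup K.constrainedSpan)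

instance : Module ℝ K.PreNative := inferInstanceAs (Module ℝ K.constrainedSpan)

/-- The function underlying an element of `L`. -/
def PreNative.fn {K : CPDKernel F} : K.PreNative →ₗ[ℝ] (X → ℝ) := K.constrainedSpan.subtype

theorem PreNative.exists_rep {K : CPDKernel F} (u : K.PreNative) :
    ∃ α ∈ constraintSpace F, K.comb α = PreNative.fn u := u.2

/-- Some coefficients of an element of `L`. -/
def PreNative.rep {K : CPDKernel F} (u : K.PreNative) : X →₀ ℝ := u.exists_rep.choose

theorem PreNative.rep_mem {K : CPDKernel F} (u : K.PreNative) :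
    u.rep ∈ constraintSpace F := u.exists_rep.choose_spec.1

theorem PreNative.comb_rep {K : CPDKernel F} (u : K.PreNative) :
    K.comb u.rep = PreNative.fn u := u.exists_rep.choose_spec.2

theorem form_eq_right (α β : X →₀ ℝ) : K.form α β = pointSum β (K.comb α) := by
  unfold form pointSum comb
  rw [Finsupp.sum_comm]
  refine Finsupp.sum_congr fun y _ => ?_
  simp [Finsupp.linearCombination_apply, Finsupp.sum, Finset.mul_sum]
  exact Finset.sum_congr rfl fun x _ => by ring

theorem form_comm (α β : X →₀ ℝ) : K.form α β = K.form β α := by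
  unfold form
  rw [Finsupp.sum_comm]
  refine Finsupp.sum_congr fun y _ => Finsupp.sum_congr fun x _ => ?_
  rw [K.symm]; ring

theorem form_self_nonneg {α : X →₀ ℝ} (h : α ∈ constraintSpace F) : 0 ≤ K.form α α := by
  let e := α.support.equivFin
  have key : ∀ g : X → ℝ, ∑ i, g (e.symm i : X) = ∑ x ∈ α.support, g x := fun g => by
    rw [← Finset.sum_coe_sort α.support g]
    exact Equiv.sum_comp e.symm fun x => g x
  have := K.cpd α.support.card (fun i => (e.symm i : X)) (fun i => α (e.symm i : X))
    (fun p hp => (key fun x => α x * p x).trans (h p hp))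
  refine this.trans_eq ?_
  unfold form Finsupp.sum
  rw [← key]
  exact Finset.sum_congr rfl fun i _ =>
    key fun y => α (e.symm i : X) * α y * K.toFun (e.symm i : X) y

/-- The inner product of `L`, computed from some coefficients of the two arguments. It does not
depend on the coefficients, see `inner_eq_form`. -/
instance : Inner ℝ K.PreNative := ⟨fun u v => K.form u.rep v.rep⟩

theorem inner_eq_form {u v : K.PreNative} {α β : X →₀ ℝ}
    (hu : K.comb α = PreNative.fn u) (hv : K.comb β = PreNative.fn v) :
    ⟪u, v⟫_ℝ = K.form α β := by
  change K.form u.rep v.rep = _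
  rw [form_eq_right, u.comb_rep, ← hu, ← form_eq_right, form_comm, form_eq_right, v.comb_rep,
    ← hv, ← form_eq_right, form_comm]

theorem inner_eq_pointSum (u v : K.PreNative) :
    ⟪u, v⟫_ℝ = pointSum v.rep (PreNative.fn u) := by
  rw [inner_eq_form K u.comb_rep v.comb_rep, form_eq_right, u.comb_rep]

instance : PreInnerProductSpace.Core ℝ K.PreNative where
  conj_inner_symm u v := K.form_comm _ _
  re_inner_nonneg u := K.form_self_nonneg u.rep_mem
  add_left u v w := by
    simp only [inner_eq_pointSum, map_add, pointSum, Pi.add_apply, mul_add, Finsupp.sum_add]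
  smul_left u v r := by
    simp only [inner_eq_pointSum, map_smul, pointSum, Pi.smul_apply, smul_eq_mul,
      Finsupp.mul_sum, conj_trivial]
    exact Finsupp.sum_congr fun x _ => by ring

instance : SeminormedAddCommGroup K.PreNative :=
  InnerProductSpace.Core.toSeminormedAddCommGroup (𝕜 := ℝ)

instance : InnerProductSpace ℝ K.PreNative := .ofCore _

/-- The reduced native space: the (Hausdorff) completion of `L`, a real Hilbert space. -/
abbrev ReducedNative : Type _ := UniformSpace.Completion K.PreNative

/-- A natural embedding of the reduced native space into `C(X)`: a continuous linear map which
sends (the class of) every `u ∈ L` to the function `u`, up to an element of `F`. The correction in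
`F` cannot be dropped: elements of `L ∩ F` have norm zero, and convergence in the norm of `L`
controls functions only up to elements of `F`. -/
def IsNaturalEmbedding (ι : K.ReducedNative →L[ℝ] C(X, ℝ)) : Prop :=
  ∀ u : K.PreNative, (ι (u : K.ReducedNative) : X → ℝ) - PreNative.fn u ∈ F

end CPDKernel

section DirectSum

variable {X E : Type*} [NormedAddCommGroup E] [InnerProductSpace ℝ E]

/-- The sum `j(E) + F` of (the image in functions of) an inner product space and `F`. -/
def sumSpace (j : E →ₗ[ℝ] (X → ℝ)) (F : Submodule ℝ (X → ℝ)) : Submodule ℝ (X → ℝ) :=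
  LinearMap.range j ⊔ F

/-- Every element of `j(E) + F` is `j u + p` for unique `u ∈ E` and `p ∈ F`. -/
def IsDirectSum (j : E →ₗ[ℝ] (X → ℝ)) (F : Submodule ℝ (X → ℝ)) : Prop :=
  Function.Injective j ∧ Disjoint (LinearMap.range j) F

open Classical in
/-- The component `u ∈ E` of a function `g = j u + p`, `p ∈ F`. -/
def perpPart (j : E →ₗ[ℝ] (X → ℝ)) (F : Submodule ℝ (X → ℝ)) (g : X → ℝ) : E :=
  if h : ∃ u : E, g - j u ∈ F then h.choose else 0

/-- The semi-inner product `⟨j u + p, j v + q⟩ = ⟨u, v⟩_E` on `j(E) ⊕ F`. -/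
def semiInner (j : E →ₗ[ℝ] (X → ℝ)) (F : Submodule ℝ (X → ℝ)) (g h : X → ℝ) : ℝ :=
  ⟪perpPart j F g, perpPart j F h⟫_ℝ

/-- The semi-norm of `j(E) ⊕ F`. -/
def semiNorm (j : E →ₗ[ℝ] (X → ℝ)) (F : Submodule ℝ (X → ℝ)) (g : X → ℝ) : ℝ :=
  Real.sqrt (semiInner j F g g)

end DirectSum

/-- The map `h ↦ ι h` with values regarded as functions. -/
def CPDKernel.embFun {X : Type*} [TopologicalSpace X] {F : Submodule ℝ (X → ℝ)}
    (K : CPDKernel F) (ι : K.ReducedNative →L[ℝ] C(X, ℝ)) : K.ReducedNative →ₗ[ℝ] (X → ℝ) :=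
  (ContinuousMap.coeFnLinearMap ℝ).comp ι.toLinearMap

section Residual

variable {X : Type*} [TopologicalSpace X] [MeasurableSpace X] {k : ℕ}

/-- `F = span {f₁, …, f_k}`, as a space of functions. -/
def featureSpan {X : Type*} [TopologicalSpace X] {k : ℕ} (f : Fin k → C(X, ℝ)) :
    Submodule ℝ (X → ℝ) :=
  Submodule.span ℝ (Set.range fun i => (f i : X → ℝ))

/-- `G = [⟨fᵢ, fⱼ⟩_{L₂(X, P)}]`. -/
def gramMatrix (f : Fin k → C(X, ℝ)) (P : Measure X) : Matrix (Fin k) (Fin k) ℝ :=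
  Matrix.of fun i j => ∫ x, f i x * f j x ∂P

/-- `P` is `F`-nondegenerate: `G` is invertible. -/
def IsNondegenerate (f : Fin k → C(X, ℝ)) (P : Measure X) : Prop :=
  IsUnit (gramMatrix f P)

/-- `Π_P g (x) = ∫ Π(x, y) g(y) dP(y)` with `Π(x, y) = ∑ᵢⱼ (G⁻¹)ᵢⱼ fᵢ(x) fⱼ(y)`, for
nondegenerate `P` (where the pseudo-inverse of `G` is its inverse). -/
def proj (f : Fin k → C(X, ℝ)) (P : Measure X) (g : X → ℝ) (x : X) : ℝ :=
  ∫ y, (∑ i, ∑ j, (gramMatrix f P)⁻¹ i j * f i x * f j y) * g y ∂P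

/-- The residual kernel `((I - Π_P) ⊗ (I - Π_P)) K`. -/
def residualKernel (f : Fin k → C(X, ℝ)) (P : Measure X) (κ : X → X → ℝ) (x y : X) : ℝ :=
  κ x y - proj f P (fun y' => κ x y') y - proj f P (fun x' => κ x' y) x
    + proj f P (fun x' => proj f P (fun y' => κ x' y') y) x

end Residual

/-- A real kernel as a matrix of multiplication operators on `ℝ`, the form in which Mathlib's
theory of reproducing kernel Hilbert spaces takes kernels. -/
def opKernel {X : Type*} (κ : X → X → ℝ) : Matrix X X (ℝ →L[ℝ] ℝ) :=
  Matrix.of fun x y => κ x y • ContinuousLinearMap.id ℝ ℝ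

/-- The reproducing kernel Hilbert space of a positive definite kernel, as a space of functions. -/
def rkhsFun {X : Type*} (κ : X → X → ℝ) [Fact (opKernel κ).PosSemidef] :
    RKHS.OfKernel (opKernel κ) →ₗ[ℝ] (X → ℝ) :=
  (RKHS.coeCLM ℝ : RKHS.OfKernel (opKernel κ) →L[ℝ] (X → ℝ)).toLinearMap

end

/-!
Everything is read off from two maps of `X` into the reduced native space `H`.

Since the `fᵢ` are linearly independent, there are finite combinations `lᵢ` of point evaluations
dual to them (`exists_dual_pointSum`). The functional `δₓ - ∑ᵢ fᵢ(x) lᵢ` annihilates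
`F = span {f₁, …, f_k}`, so it has a class `Φ x ∈ H` (`CPDKernel.reducedEval`). The map `Φ` is
continuous because its Gram kernel is, and `h ↦ ⟨Φ ·, h⟩` is a natural embedding `ι₀`
(`CPDKernel.canonicalEmbedding`). Any other natural embedding agrees with `ι₀` up to `F`
(`CPDKernel.IsNaturalEmbedding.sub_mem`), and `ι₀ h ∈ F` forces `h = 0`
(`CPDKernel.eq_zero_of_inner_reducedEval_mem`), because the elements of `L` are combinations of
the `Φ x` with coefficients annihilating `F`.

Put `Ψ = (I - Π_P) Φ` (`CPDKernel.residualEval`), where `Π_P` acts on `H`-valued functions through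
a Bochner integral. Then `⟨Ψ ·, h⟩ = (I - Π_P) (ι₀ h)` differs from `ι₀ h` by an element of `F`.
The kernel `⟨Φ x, Φ y⟩` differs from `K` only by terms killed by `(I - Π_P) ⊗ (I - Π_P)`, so
`K_P(x, y) = ⟨Ψ x, Ψ y⟩` (`CPDKernel.residualKernel_eq_inner`). Hence `K_P` is positive definite,
without any approximation of `P` by discrete measures, and, the `Ψ x` being total in `H`, there is
an isometry `U` of the reproducing kernel Hilbert space of `K_P` onto `H` with `w = ⟨Ψ ·, U w⟩`
(`exists_isometryEquiv_rkhs`). So `w` and `ι (U w)` agree up to `F` for every natural embedding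
`ι`, and the two semi-inner product spaces coincide (`IsDirectSum.of_isometryEquiv` and the lemmas
after it).
-/

noncomputable section

theorem pointSum_eq_linearCombination {X : Type*} (α : X →₀ ℝ) (g : X → ℝ) :
    pointSum α g = Finsupp.linearCombination ℝ g α := rfl

/-! ### Direct sums with a fixed function space and their semi-inner products -/

section DirectSum

variable {X E E' : Type*} [NormedAddCommGroup E] [InnerProductSpace ℝ E]
  [NormedAddCommGroup E'] [InnerProductSpace ℝ E'] {F : Submodule ℝ (X → ℝ)}

theorem isDirectSum_of_forall {j : E →ₗ[ℝ] (X → ℝ)} (h : ∀ u, j u ∈ F → u = 0) :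
    IsDirectSum j F := by
  refine ⟨(injective_iff_map_eq_zero j).2 fun u hu => h u (hu ▸ F.zero_mem), ?_⟩
  rw [Submodule.disjoint_def]
  rintro _ ⟨u, rfl⟩ hu
  rw [h u hu, map_zero]

theorem IsDirectSum.eq_zero {j : E →ₗ[ℝ] (X → ℝ)} (h : IsDirectSum j F) {u : E}
    (hu : j u ∈ F) : u = 0 :=
  h.1 ((Submodule.disjoint_def.1 h.2 _ ⟨u, rfl⟩ hu).trans (map_zero j).symm)

/-- For a direct sum, `perpPart` really is the component: it does not depend on the choice made in
its definition. -/
theorem IsDirectSum.perpPart_eq {j : E →ₗ[ℝ] (X → ℝ)} (h : IsDirectSum j F) {g : X → ℝ} {u : E}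
    (hu : g - j u ∈ F) : perpPart j F g = u := by
  have hex : ∃ u : E, g - j u ∈ F := ⟨u, hu⟩
  rw [perpPart, dif_pos hex, ← sub_eq_zero]
  refine h.eq_zero ?_
  rw [map_sub]
  convert F.sub_mem hu hex.choose_spec using 1
  abel

theorem exists_sub_mem_of_mem_sumSpace {j : E →ₗ[ℝ] (X → ℝ)} {g : X → ℝ}
    (hg : g ∈ sumSpace j F) : ∃ u, g - j u ∈ F := by
  obtain ⟨_, ⟨u, rfl⟩, p, hp, rfl⟩ := Submodule.mem_sup.1 hg
  exact ⟨u, by simpa using hp⟩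

variable {j : E →ₗ[ℝ] (X → ℝ)} {j' : E' →ₗ[ℝ] (X → ℝ)} (U : E ≃ₗᵢ[ℝ] E')

theorem sub_comp_symm_mem (hU : ∀ u, j u - j' (U u) ∈ F) (v : E') :
    j' v - j (U.symm v) ∈ F := by
  have := F.neg_mem (hU (U.symm v))
  rwa [neg_sub, U.apply_symm_apply] at this

/-- If `j u` and `j' (U u)` always agree up to `F`, then `j(E) ⊕ F` and `j'(E') ⊕ F` are the same
semi-inner product space, with components corresponding under `U`. This lemma transfers
directness; `sumSpace_eq_of_isometryEquiv` and `semiInner_isometryEquiv` give the rest. -/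
theorem IsDirectSum.of_isometryEquiv (hU : ∀ u, j u - j' (U u) ∈ F) (h : IsDirectSum j' F) :
    IsDirectSum j F := by
  refine isDirectSum_of_forall fun u hu => ?_
  have := h.eq_zero (u := U u) (by simpa using F.sub_mem hu (hU u))
  simpa using this

theorem sumSpace_le_of_forall_sub_mem {T : E → E'} (hT : ∀ u, j u - j' (T u) ∈ F) :
    sumSpace j F ≤ sumSpace j' F := by
  refine sup_le ?_ le_sup_right
  rintro _ ⟨u, rfl⟩
  exact Submodule.mem_sup.2 ⟨_, ⟨T u, rfl⟩, _, hT u, by abel⟩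

theorem sumSpace_eq_of_isometryEquiv (hU : ∀ u, j u - j' (U u) ∈ F) :
    sumSpace j F = sumSpace j' F :=
  le_antisymm (sumSpace_le_of_forall_sub_mem hU)
    (sumSpace_le_of_forall_sub_mem (sub_comp_symm_mem U hU))

theorem perpPart_isometryEquiv (hU : ∀ u, j u - j' (U u) ∈ F) (h : IsDirectSum j' F)
    {g : X → ℝ} (hg : g ∈ sumSpace j F) : perpPart j' F g = U (perpPart j F g) := by
  obtain ⟨u, hu⟩ := exists_sub_mem_of_mem_sumSpace hg
  rw [(h.of_isometryEquiv U hU).perpPart_eq hu]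
  refine h.perpPart_eq ?_
  simpa using F.add_mem hu (hU u)

theorem semiInner_isometryEquiv (hU : ∀ u, j u - j' (U u) ∈ F) (h : IsDirectSum j' F)
    {g₁ g₂ : X → ℝ} (h₁ : g₁ ∈ sumSpace j F) (h₂ : g₂ ∈ sumSpace j F) :
    semiInner j' F g₁ g₂ = semiInner j F g₁ g₂ := by
  rw [semiInner, semiInner, perpPart_isometryEquiv U hU h h₁, perpPart_isometryEquiv U hU h h₂,
    U.inner_map_map]

theorem IsDirectSum.semiNorm_add (h : IsDirectSum j F) (u : E) {p : X → ℝ} (hp : p ∈ F) :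
    semiNorm j F (j u + p) = ‖u‖ := by
  rw [semiNorm, semiInner, h.perpPart_eq (u := u) (by simpa using hp),
    real_inner_self_eq_norm_sq, Real.sqrt_sq (norm_nonneg _)]

end DirectSum

/-! ### Feature maps and the reproducing kernel Hilbert space -/

section FeatureMap

variable {X H : Type*} [NormedAddCommGroup H] [InnerProductSpace ℝ H] {κ : X → X → ℝ}
  {Ψ : X → H}

theorem denseRange_linearCombination_of_forall_inner [CompleteSpace H]
    (hΨ : ∀ h : H, (∀ x, ⟪Ψ x, h⟫_ℝ = 0) → h = 0) :
    DenseRange (Finsupp.linearCombination ℝ Ψ) := by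
  rw [DenseRange, ← LinearMap.coe_range, Submodule.dense_iff_topologicalClosure_eq_top,
    Submodule.topologicalClosure_eq_top_iff, eq_bot_iff]
  intro h hh
  exact hΨ h fun x => hh _ ⟨Finsupp.single x 1, by simp⟩

theorem norm_linearCombination_of_inner (hκ : ∀ x y, κ x y = ⟪Ψ x, Ψ y⟫_ℝ) (α : X →₀ ℝ) :
    ‖Finsupp.linearCombination ℝ Ψ α‖ =
      Real.sqrt (α.sum fun x a => α.sum fun y b => a * b * κ x y) := by
  rw [norm_eq_sqrt_real_inner, Finsupp.linearCombination_apply, Finsupp.sum_inner]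
  congr 1
  refine Finsupp.sum_congr fun x _ => ?_
  rw [Finsupp.inner_sum]
  refine Finsupp.sum_congr fun y _ => ?_
  rw [inner_smul_left, inner_smul_right, hκ, mul_assoc]
  rfl

theorem posSemidef_opKernel_of_inner (hκ : ∀ x y, κ x y = ⟪Ψ x, Ψ y⟫_ℝ) :
    (opKernel κ).PosSemidef := by
  have hsymm : (opKernel κ).IsHermitian := by
    ext x y
    simp [opKernel, Matrix.conjTranspose_apply, hκ, real_inner_comm, star, ContinuousLinearMap.adjoint_id]
  have htfae := (RKHS.posSemidef_tfae (K := opKernel κ)).out 0 2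
  refine htfae.2 ⟨hsymm, fun v => ?_⟩
  have : (v.sum fun x w => v.sum fun x' w' => ⟪opKernel κ x' x w, w'⟫_ℝ) =
      ⟪v.sum fun x w => w • Ψ x, v.sum fun x w => w • Ψ x⟫_ℝ := by
    rw [Finsupp.sum_inner]
    refine Finsupp.sum_congr fun x _ => ?_
    rw [Finsupp.inner_sum]
    refine Finsupp.sum_congr fun y _ => ?_
    rw [inner_smul_left, inner_smul_right, ← hκ]
    have := hκ y x
    rw [real_inner_comm, ← hκ] at this
    simp [opKernel, this]
    ring
  rw [this]
  exact inner_self_nonneg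

/-- A kernel `⟨Ψ x, Ψ y⟩` given by a total feature map `Ψ` into a Hilbert space `H` has a reproducing
kernel Hilbert space isometric to `H`, with `U w` represented by the function `x ↦ ⟨Ψ x, U w⟩`.
The kernel functions on one side and the `Ψ x` on the other have the same Gram matrix and a dense
span, so the correspondence between them extends to the whole spaces. -/
theorem exists_isometryEquiv_rkhs [CompleteSpace H] [Fact (opKernel κ).PosSemidef]
    (hκ : ∀ x y, κ x y = ⟪Ψ x, Ψ y⟫_ℝ) (hΨ : ∀ h : H, (∀ x, ⟪Ψ x, h⟫_ℝ = 0) → h = 0) :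
    ∃ U : RKHS.OfKernel (opKernel κ) ≃ₗᵢ[ℝ] H, ∀ w x, rkhsFun κ w x = ⟪Ψ x, U w⟫_ℝ := by
  let R := RKHS.OfKernel (opKernel κ)
  let Θ : X → R := fun x => RKHS.kerFun R x 1
  have hΘ (w : R) (x : X) : ⟪Θ x, w⟫_ℝ = rkhsFun κ w x := by
    simp only [Θ, RKHS.kerFun_inner]
    simp [rkhsFun]
  have hΘΘ (x y : X) : ⟪Θ x, Θ y⟫_ℝ = κ x y := by
    simp only [Θ, RKHS.kerFun_inner, RKHS.kerFun_apply, R, RKHS.OfKernel.kernel_ofKernel]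
    simp [opKernel]
  have dΘ : DenseRange (Finsupp.linearCombination ℝ Θ) :=
    denseRange_linearCombination_of_forall_inner fun w hw => RKHS.ext fun x => by
      have := hw x
      rw [hΘ] at this
      simpa [rkhsFun] using this
  have dΨ := denseRange_linearCombination_of_forall_inner hΨ
  have hnorm (α : X →₀ ℝ) : ‖Finsupp.linearCombination ℝ Ψ (LinearEquiv.refl ℝ (X →₀ ℝ) α)‖ =
      ‖Finsupp.linearCombination ℝ Θ α‖ := by
    rw [norm_linearCombination_of_inner (fun x y => (hΘΘ x y).symm), LinearEquiv.refl_apply,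
      norm_linearCombination_of_inner hκ]
  let U : R ≃ₗᵢ[ℝ] H := (LinearEquiv.refl ℝ (X →₀ ℝ)).extendOfIsometry
    (Finsupp.linearCombination ℝ Θ) (Finsupp.linearCombination ℝ Ψ) dΘ dΨ hnorm
  have hU (x : X) : U (Θ x) = Ψ x := by
    have := LinearEquiv.extendOfIsometry_eq (LinearEquiv.refl ℝ (X →₀ ℝ))
      (Finsupp.linearCombination ℝ Θ) (Finsupp.linearCombination ℝ Ψ) dΘ dΨ hnorm
      (Finsupp.single x 1)
    simpa using this
  exact ⟨U, fun w x => by rw [← hU, U.inner_map_map, hΘ]⟩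

end FeatureMap

/-! ### Corrected point functionals in the reduced native space -/

section Reduced

variable {X : Type*} [TopologicalSpace X] {k : ℕ} {f : Fin k → C(X, ℝ)}

theorem mem_constraintSpace_featureSpan {α : X →₀ ℝ} :
    α ∈ constraintSpace (featureSpan f) ↔ ∀ i, pointSum α (f i) = 0 := by
  refine ⟨fun h i => h _ (Submodule.subset_span ⟨i, rfl⟩), fun h p hp => ?_⟩
  induction hp using Submodule.span_induction with
  | mem p hp => obtain ⟨i, rfl⟩ := hp; exact h i
  | zero => simp [pointSum]
  | add p q _ _ hp hq =>
    rw [pointSum_eq_linearCombination] at hp hq ⊢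
    simp only [Finsupp.linearCombination_apply, smul_add, Pi.add_apply,
      Finsupp.sum_add] at hp hq ⊢
    rw [hp, hq, add_zero]
  | smul c p _ hp =>
    simp only [pointSum, Pi.smul_apply, smul_eq_mul, mul_left_comm _ c, ← Finsupp.mul_sum] at hp ⊢
    rw [hp, mul_zero]

theorem sum_mul_mem_featureSpan (c : Fin k → ℝ) :
    (fun x => ∑ i, c i * f i x) ∈ featureSpan f := by
  have : (fun x => ∑ i, c i * f i x) = ∑ i, c i • (f i : X → ℝ) := by
    ext x; simp
  rw [this]
  exact Submodule.sum_mem _ fun i _ => Submodule.smul_mem _ _ (Submodule.subset_span ⟨i, rfl⟩)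

/-- Linearly independent functions admit a dual family of finite combinations of point evaluations:
the vectors `(f₁(x), …, f_k(x))`, `x ∈ X`, span `ℝᵏ`. -/
theorem exists_dual_pointSum (hf : LinearIndependent ℝ f) :
    ∃ l : Fin k → X →₀ ℝ, ∀ i j, pointSum (l i) (f j) = if i = j then 1 else 0 := by
  have hf' : LinearIndependent ℝ fun i => (f i : X → ℝ) :=
    hf.map' (ContinuousMap.coeFnLinearMap ℝ) (LinearMap.ker_eq_bot.2 DFunLike.coe_injective)
  have hspan := span_flip_eq_top_iff_linearIndependent.2 hf'
  have hsurj : ∀ v : Fin k → ℝ, ∃ α : X →₀ ℝ, ∀ j, pointSum α (f j) = v j := fun v => by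
    have hv : v ∈ Submodule.span ℝ (Set.range (flip fun i => (f i : X → ℝ))) :=
      hspan ▸ Submodule.mem_top
    obtain ⟨α, rfl⟩ := (Finsupp.mem_span_range_iff_exists_finsupp).1 hv
    exact ⟨α, fun j => by simp [pointSum, Finsupp.sum, flip]⟩
  choose l hl using fun i : Fin k => hsurj fun j => if i = j then 1 else 0
  exact ⟨l, hl⟩

/-- The correction `α - ∑ᵢ (∑ₓ α(x) fᵢ(x)) lᵢ` of a coefficient family. When the `lᵢ` are dual to
the `fᵢ`, it is the projection onto the coefficient families annihilating `span {f₁, …, f_k}`. -/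
def annihilatorProj (f : Fin k → C(X, ℝ)) (l : Fin k → X →₀ ℝ) : (X →₀ ℝ) →ₗ[ℝ] (X →₀ ℝ) :=
  LinearMap.id - ∑ i, (Finsupp.linearCombination ℝ (f i : X → ℝ)).smulRight (l i)

theorem annihilatorProj_apply (l : Fin k → X →₀ ℝ) (α : X →₀ ℝ) :
    annihilatorProj f l α = α - ∑ i, pointSum α (f i) • l i := by
  simp [annihilatorProj, pointSum_eq_linearCombination]

theorem pointSum_annihilatorProj (l : Fin k → X →₀ ℝ) (α : X →₀ ℝ) (g : X → ℝ) :
    pointSum (annihilatorProj f l α) g =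
      pointSum α g - ∑ i, pointSum α (f i) * pointSum (l i) g := by
  rw [annihilatorProj_apply]
  simp [pointSum_eq_linearCombination]

variable {l : Fin k → X →₀ ℝ}

theorem annihilatorProj_mem (hl : ∀ i j, pointSum (l i) (f j) = if i = j then 1 else 0)
    (α : X →₀ ℝ) : annihilatorProj f l α ∈ constraintSpace (featureSpan f) := by
  refine mem_constraintSpace_featureSpan.2 fun j => ?_
  simp [pointSum_annihilatorProj, hl]

theorem annihilatorProj_of_mem {α : X →₀ ℝ} (hα : α ∈ constraintSpace (featureSpan f)) :
    annihilatorProj f l α = α := by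
  simp [annihilatorProj_apply, mem_constraintSpace_featureSpan.1 hα]

variable (K : CPDKernel (featureSpan f))

namespace CPDKernel

/-- The class in the reduced native space of the function `∑ᵢ αᵢ K(xᵢ, ·)`. -/
def toReduced {F : Submodule ℝ (X → ℝ)} (K : CPDKernel F) :
    constraintSpace F →ₗ[ℝ] K.ReducedNative :=
  (UniformSpace.Completion.toComplL (𝕜 := ℝ) (E := K.PreNative)).toLinearMap ∘ₗ
    (show constraintSpace F →ₗ[ℝ] K.PreNative from K.comb.submoduleMap (constraintSpace F))

theorem exists_toReduced_eq {F : Submodule ℝ (X → ℝ)} (K : CPDKernel F) (u : K.PreNative) :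
    ∃ α : constraintSpace F, K.toReduced α = u ∧ K.comb α = PreNative.fn u :=
  ⟨⟨u.rep, u.rep_mem⟩, congrArg (fun v : K.PreNative => (v : K.ReducedNative)) (Subtype.ext u.comb_rep),
    u.comb_rep⟩

theorem inner_toReduced {F : Submodule ℝ (X → ℝ)} (K : CPDKernel F) (α β : constraintSpace F) :
    ⟪K.toReduced α, K.toReduced β⟫_ℝ = pointSum α (K.comb β) := by
  rw [← form_eq_right, form_comm]
  exact (UniformSpace.Completion.inner_coe _ _).trans (K.inner_eq_form rfl rfl)

theorem denseRange_toReduced {F : Submodule ℝ (X → ℝ)} (K : CPDKernel F) :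
    DenseRange K.toReduced := by
  refine UniformSpace.Completion.denseRange_coe.mono ?_
  rintro _ ⟨u, rfl⟩
  obtain ⟨α, hα, -⟩ := K.exists_toReduced_eq u
  exact ⟨α, hα⟩

variable (hl : ∀ i j, pointSum (l i) (f j) = if i = j then 1 else 0)

/-- The point functional `δₓ`, corrected to annihilate `span {f₁, …, f_k}`, as an element of the
reduced native space. -/
def reducedEval (x : X) : K.ReducedNative :=
  K.toReduced ⟨annihilatorProj f l (Finsupp.single x 1), annihilatorProj_mem hl _⟩

theorem inner_reducedEval_toReduced (x : X) (β : constraintSpace (featureSpan f)) :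
    ⟪K.reducedEval hl x, K.toReduced β⟫_ℝ =
      K.comb β x - ∑ i, f i x * pointSum (l i) (K.comb β) := by
  rw [reducedEval, inner_toReduced, pointSum_annihilatorProj]
  simp [pointSum]

/-- On coefficients annihilating `F` the corrections cancel, so the corrected point functionals
`reducedEval` span a dense subspace of the reduced native space. -/
theorem toReduced_eq_linearCombination (α : constraintSpace (featureSpan f)) :
    K.toReduced α = Finsupp.linearCombination ℝ (K.reducedEval hl) α := by
  have h : K.toReduced ∘ₗ (annihilatorProj f l).codRestrict _ (annihilatorProj_mem hl) =
      Finsupp.linearCombination ℝ (K.reducedEval hl) := by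
    ext x
    simp [reducedEval, LinearMap.codRestrict]
  rw [← h]
  exact congrArg _ (Subtype.ext (annihilatorProj_of_mem α.2).symm)

theorem inner_toReduced_left (α : constraintSpace (featureSpan f)) (h : K.ReducedNative) :
    ⟪K.toReduced α, h⟫_ℝ = pointSum α fun x => ⟪K.reducedEval hl x, h⟫_ℝ := by
  rw [K.toReduced_eq_linearCombination hl, Finsupp.linearCombination_apply, Finsupp.sum_inner]
  simp [pointSum, inner_smul_left]

/-- A vector represented by a function in `F` is orthogonal to every element of `L`, since the
coefficients of that element annihilate `F`. This is why the sums with `F` are direct. -/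
theorem eq_zero_of_inner_reducedEval_mem {h : K.ReducedNative}
    (hh : (fun x => ⟪K.reducedEval hl x, h⟫_ℝ) ∈ featureSpan f) : h = 0 := by
  refine K.denseRange_toReduced.eq_zero_of_inner_right ℝ fun α => ?_
  rw [K.inner_toReduced_left hl]
  exact α.2 _ hh

theorem continuous_comb (α : X →₀ ℝ) : Continuous (K.comb α) := by
  have (x : X) : Continuous (K.toFun x) :=
    K.continuous.comp (by fun_prop : Continuous fun y => (x, y))
  have h : K.comb α = fun y => ∑ x ∈ α.support, α x * K.toFun x y := by
    ext y; simp [comb, Finsupp.linearCombination_apply, Finsupp.sum]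
  rw [h]
  fun_prop

/-- The kernel of the corrected point functionals is `K` up to terms that are products of some `fᵢ`
in one variable with a function of the other. Applying `I - Π_P` in both variables removes them. -/
theorem inner_reducedEval_reducedEval (x y : X) :
    ⟪K.reducedEval hl x, K.reducedEval hl y⟫_ℝ =
      K.toFun x y - ∑ i, f i y * K.comb (l i) x - ∑ i, f i x * K.comb (l i) y
        + ∑ i, f i x * ∑ j, f j y * pointSum (l i) (K.comb (l j)) := by
  have h (z : X) : K.comb (annihilatorProj f l (Finsupp.single y 1)) z =
      K.toFun y z - ∑ i, f i y * K.comb (l i) z := by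
    rw [annihilatorProj_apply]
    simp [pointSum, comb]
  have hs (i : Fin k) : pointSum (l i) (K.toFun y) = K.comb (l i) y := by
    simp [pointSum, comb, Finsupp.linearCombination_apply, Finsupp.sum, K.symm y]
  have hp (i : Fin k) : pointSum (l i) (K.comb (annihilatorProj f l (Finsupp.single y 1))) =
      K.comb (l i) y - ∑ j, f j y * pointSum (l i) (K.comb (l j)) := by
    rw [← hs, show K.comb (annihilatorProj f l (Finsupp.single y 1)) = _ from funext h]
    simp only [pointSum, mul_sub, Finsupp.sum_sub, Finset.mul_sum, Finsupp.mul_sum]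
    rw [Finsupp.sum_finsetSum_comm]
    simp only [mul_left_comm]
  change ⟪K.reducedEval hl x, K.toReduced _⟫_ℝ = _
  rw [inner_reducedEval_toReduced]
  simp only [h, hp, mul_sub, Finset.sum_sub_distrib, K.symm y x]
  ring

theorem continuous_reducedEval : Continuous (K.reducedEval hl) := by
  have hc := K.continuous
  have hcomb (i : Fin k) := K.continuous_comb (l i)
  have hk : Continuous fun z : X × X => ⟪K.reducedEval hl z.1, K.reducedEval hl z.2⟫_ℝ := by
    simp only [inner_reducedEval_reducedEval]
    fun_prop
  rw [continuous_iff_continuousAt]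
  intro x
  rw [ContinuousAt, tendsto_iff_norm_sub_tendsto_zero]
  have hd : Continuous fun y => Real.sqrt (⟪K.reducedEval hl y, K.reducedEval hl y⟫_ℝ
      - 2 * ⟪K.reducedEval hl y, K.reducedEval hl x⟫_ℝ
      + ⟪K.reducedEval hl x, K.reducedEval hl x⟫_ℝ) := by
    have h₁ := hk.comp (by fun_prop : Continuous fun y : X => (y, y))
    have h₂ := hk.comp (by fun_prop : Continuous fun y : X => (y, x))
    simp only [Function.comp_def] at h₁ h₂
    fun_prop
  have h0 := hd.tendsto x
  convert h0 using 1
  · ext y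
    rw [norm_eq_sqrt_real_inner, real_inner_sub_sub_self]
  · congr 1
    rw [eq_comm, Real.sqrt_eq_zero']
    linarith

/-! ### Natural embeddings -/

variable {K} in
/-- Two natural embeddings differ by values in `F`: this holds on the dense subspace `L`, and `F` is
closed in `C(X)` because it is finite-dimensional. -/
theorem IsNaturalEmbedding.sub_mem {ι ι' : K.ReducedNative →L[ℝ] C(X, ℝ)}
    (h : K.IsNaturalEmbedding ι) (h' : K.IsNaturalEmbedding ι') (u : K.ReducedNative) :
    K.embFun ι u - K.embFun ι' u ∈ featureSpan f := by
  have hmap : featureSpan f = (Submodule.span ℝ (Set.range f)).map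
      (ContinuousMap.coeFnLinearMap ℝ) := by
    rw [Submodule.map_span, ← Set.range_comp]; rfl
  have hmem (g : C(X, ℝ)) : (g : X → ℝ) ∈ featureSpan f ↔ g ∈ Submodule.span ℝ (Set.range f) := by
    rw [hmap]
    refine ⟨?_, fun hg => ⟨g, hg, rfl⟩⟩
    rintro ⟨g', hg', he⟩
    rwa [← (DFunLike.coe_injective he : g' = g)]
  have : FiniteDimensional ℝ (Submodule.span ℝ (Set.range f)) :=
    FiniteDimensional.span_of_finite ℝ (Set.finite_range f)
  have hclosed := (Submodule.span ℝ (Set.range f)).closed_of_finiteDimensional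
  refine (hmem (ι u - ι' u)).2 ?_
  induction u using UniformSpace.Completion.induction_on with
  | hp => exact hclosed.preimage (by fun_prop : Continuous fun u => ι u - ι' u)
  | ih u =>
    refine (hmem _).1 ?_
    convert (featureSpan f).sub_mem (h u) (h' u) using 1
    simp

section Embedding

variable [CompactSpace X]

/-- The natural embedding `h ↦ (x ↦ ⟨Φ x, h⟩)` with `Φ x` the class of the corrected point
functional at `x`. -/
def canonicalEmbedding : K.ReducedNative →L[ℝ] C(X, ℝ) :=
  let Φ : C(X, K.ReducedNative) := ⟨K.reducedEval hl, K.continuous_reducedEval hl⟩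
  LinearMap.mkContinuous
    { toFun := fun h => ⟨fun x => ⟪Φ x, h⟫_ℝ, by fun_prop⟩
      map_add' := fun h h' => by ext x; simp [inner_add_right]
      map_smul' := fun c h => by ext x; simp [inner_smul_right] }
    ‖Φ‖ fun h => (ContinuousMap.norm_le _ (by positivity)).2 fun x =>
      (norm_inner_le_norm _ _).trans (mul_le_mul_of_nonneg_right (Φ.norm_coe_le_norm x) (norm_nonneg h))

theorem canonicalEmbedding_apply (h : K.ReducedNative) (x : X) :
    K.canonicalEmbedding hl h x = ⟪K.reducedEval hl x, h⟫_ℝ := rfl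

theorem isNaturalEmbedding_canonicalEmbedding :
    K.IsNaturalEmbedding (K.canonicalEmbedding hl) := by
  intro u
  obtain ⟨α, hα, hu⟩ := K.exists_toReduced_eq u
  rw [← hα, ← hu]
  convert sum_mul_mem_featureSpan (f := f) fun i => -pointSum (l i) (K.comb α) using 1
  ext x
  simp [canonicalEmbedding_apply, inner_reducedEval_toReduced, mul_comm]

end Embedding

end CPDKernel

end Reduced

/-! ### The projection `Π_P` and the residual kernel -/

section Projection

variable {X : Type*} [TopologicalSpace X] [MeasurableSpace X] {k : ℕ} (f : Fin k → C(X, ℝ))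
  (P : Measure X) {E : Type*} [NormedAddCommGroup E] [InnerProductSpace ℝ E]

/-- The coefficients `∑ⱼ (G⁻¹)ᵢⱼ ∫ fⱼ g dP` of the projection of a vector-valued function `g`. -/
def projCoeff (g : X → E) (i : Fin k) : E :=
  ∑ j, (gramMatrix f P)⁻¹ i j • ∫ y, f j y • g y ∂P

theorem projCoeff_feature (hP : IsNondegenerate f P) (i m : Fin k) :
    projCoeff f P (f m) i = if i = m then 1 else 0 := by
  have h : (gramMatrix f P)⁻¹ * gramMatrix f P = 1 :=
    Matrix.nonsing_inv_mul _ ((Matrix.isUnit_iff_isUnit_det _).1 hP)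
  rw [← Matrix.one_apply, ← h, Matrix.mul_apply]
  rfl

variable [CompactSpace X] [BorelSpace X] [IsFiniteMeasure P]

theorem Continuous.integrable_of_compactSpace {E : Type*} [NormedAddCommGroup E] {g : X → E}
    (hg : Continuous g) : Integrable g P :=
  hg.integrable_of_hasCompactSupport (HasCompactSupport.of_compactSpace g)

theorem proj_eq_sum_projCoeff {g : X → ℝ} (hg : Continuous g) (x : X) :
    proj f P g x = ∑ i, projCoeff f P g i * f i x := by
  have h : ∀ y, (∑ i, ∑ j, (gramMatrix f P)⁻¹ i j * f i x * f j y) * g y =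
      ∑ i, ∑ j, (gramMatrix f P)⁻¹ i j * f i x * (f j y • g y) := fun y => by
    simp [Finset.sum_mul, mul_assoc]
  have hint (j : Fin k) : Integrable (fun y => f j y • g y) P :=
    Continuous.integrable_of_compactSpace P (by fun_prop)
  simp only [proj, h, projCoeff, smul_eq_mul, Finset.sum_mul] at hint ⊢
  rw [integral_finsetSum _ fun i _ => integrable_finsetSum _ fun j _ => (hint j).const_mul _]
  refine Finset.sum_congr rfl fun i _ => ?_
  rw [integral_finsetSum _ fun j _ => (hint j).const_mul _]
  refine Finset.sum_congr rfl fun j _ => ?_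
  rw [integral_const_mul]
  ring

/-- The coefficients of the projection of a Hilbert-space-valued function represent those of its
scalar sections, so `Π_P` may be applied to feature maps. -/
theorem inner_projCoeff [CompleteSpace E] {g : X → E} (hg : Continuous g) (h : E) (i : Fin k) :
    ⟪projCoeff f P g i, h⟫_ℝ = projCoeff f P (fun y => ⟪g y, h⟫_ℝ) i := by
  rw [projCoeff, projCoeff, sum_inner]
  refine Finset.sum_congr rfl fun j _ => ?_
  rw [inner_smul_left, real_inner_comm,
    ← integral_inner (Continuous.integrable_of_compactSpace P (by fun_prop)) h]
  simp [inner_smul_right, real_inner_comm]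

theorem proj_feature (hP : IsNondegenerate f P) (m : Fin k) : proj f P (f m) = f m := by
  ext x
  simp [proj_eq_sum_projCoeff f P (f m).continuous, projCoeff_feature f P hP]

/-- `Π_P` as a linear map on continuous functions. -/
def projLinear : C(X, ℝ) →ₗ[ℝ] (X → ℝ) where
  toFun g := proj f P g
  map_add' g h := by
    ext x
    simp only [proj, ContinuousMap.coe_add, Pi.add_apply, mul_add]
    exact integral_add (Continuous.integrable_of_compactSpace P (by fun_prop))
      (Continuous.integrable_of_compactSpace P (by fun_prop))
  map_smul' c g := by
    ext x
    simp only [proj, ContinuousMap.coe_smul, Pi.smul_apply, smul_eq_mul, RingHom.id_apply,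
      mul_left_comm _ c]
    exact integral_const_mul _ _

theorem projLinear_apply (g : C(X, ℝ)) : projLinear f P g = proj f P g := rfl

theorem projLinear_feature (hP : IsNondegenerate f P) (m : Fin k) :
    projLinear f P (f m) = f m := proj_feature f P hP m

variable {f P}

namespace CPDKernel

variable (K : CPDKernel (featureSpan f)) {l : Fin k → X →₀ ℝ}
  (hl : ∀ i j, pointSum (l i) (f j) = if i = j then 1 else 0)

variable (P) in
/-- The feature map of the residual kernel: the representative of the functional
`h ↦ ((I - Π_P) h)(x)` on the reduced native space. -/
def residualEval (x : X) : K.ReducedNative :=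
  K.reducedEval hl x - ∑ i, f i x • projCoeff f P (K.reducedEval hl) i

theorem inner_residualEval (x : X) (h : K.ReducedNative) :
    ⟪K.residualEval P hl x, h⟫_ℝ = ⟪K.reducedEval hl x, h⟫_ℝ -
      proj f P (fun z => ⟪K.reducedEval hl z, h⟫_ℝ) x := by
  have hc := K.continuous_reducedEval hl
  rw [proj_eq_sum_projCoeff f P (by fun_prop), residualEval, inner_sub_left, sum_inner]
  simp [inner_smul_left, inner_projCoeff f P hc, mul_comm]

theorem eq_zero_of_inner_residualEval {h : K.ReducedNative}
    (hh : ∀ x, ⟪K.residualEval P hl x, h⟫_ℝ = 0) : h = 0 := by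
  have hc := K.continuous_reducedEval hl
  refine K.eq_zero_of_inner_reducedEval_mem hl ?_
  convert sum_mul_mem_featureSpan (f := f)
    (projCoeff f P fun z => ⟪K.reducedEval hl z, h⟫_ℝ) using 1
  ext x
  rw [← proj_eq_sum_projCoeff f P (by fun_prop), ← sub_eq_zero, ← inner_residualEval, hh]

/-- The function `z ↦ ⟨Φ z, Ψ y⟩` represented by the residual functional at `y`: it is
`(I - Π_P)[K(z, ·)](y)` up to an element of `span {f₁, …, f_k}` as a function of `z`. -/
theorem inner_reducedEval_residualEval (hP : IsNondegenerate f P) (z y : X) :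
    ⟪K.reducedEval hl z, K.residualEval P hl y⟫_ℝ = K.toFun z y - proj f P (K.toFun z) y
      - ∑ i, f i z * (K.comb (l i) y - proj f P (K.comb (l i)) y) := by
  let κ : C(X, ℝ) := ⟨K.toFun z, K.continuous.comp (by fun_prop : Continuous fun y => (z, y))⟩
  let u (i : Fin k) : C(X, ℝ) := ⟨K.comb (l i), K.continuous_comb (l i)⟩
  -- `g` is `⟨Φ z, Φ ·⟩`, with the terms in `span {f₁, …, f_k}` collected in the coefficients `c`.
  let c (j : Fin k) : ℝ := ∑ i, f i z * pointSum (l i) (K.comb (l j)) - K.comb (l j) z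
  let g : C(X, ℝ) := κ - ∑ i, f i z • u i + ∑ j, c j • f j
  have hg (w : X) : ⟪K.reducedEval hl w, K.reducedEval hl z⟫_ℝ = g w := by
    rw [real_inner_comm, inner_reducedEval_reducedEval]
    have : ∑ i, f i z * ∑ j, f j w * pointSum (l i) (K.comb (l j)) =
        ∑ j, (∑ i, f i z * pointSum (l i) (K.comb (l j))) * f j w := by
      simp only [Finset.mul_sum, Finset.sum_mul]
      rw [Finset.sum_comm]
      exact Finset.sum_congr rfl fun _ _ => Finset.sum_congr rfl fun _ _ => by ring
    rw [this]
    simp only [g, c, κ, u, ContinuousMap.add_apply, ContinuousMap.sub_apply,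
      ContinuousMap.sum_apply, ContinuousMap.smul_apply, ContinuousMap.coe_mk, smul_eq_mul,
      sub_mul, Finset.sum_sub_distrib, mul_comm (f _ w)]
    ring
  rw [real_inner_comm, inner_residualEval]
  simp only [hg]
  rw [← projLinear_apply]
  simp only [g, map_add, map_sub, map_sum, map_smul, projLinear_feature f P hP,
    ContinuousMap.add_apply, ContinuousMap.sub_apply, ContinuousMap.sum_apply,
    ContinuousMap.smul_apply, Pi.add_apply, Pi.sub_apply, Finset.sum_apply, Pi.smul_apply,
    smul_eq_mul, mul_sub, Finset.sum_sub_distrib]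
  simp only [projLinear_apply, κ, u, ContinuousMap.coe_mk]
  ring

/-- `residualEval` is a feature map of the residual kernel; in particular the residual kernel is
positive definite. -/
theorem residualKernel_eq_inner (hP : IsNondegenerate f P) (x y : X) :
    residualKernel f P K.toFun x y = ⟪K.residualEval P hl x, K.residualEval P hl y⟫_ℝ := by
  have hc := K.continuous_reducedEval hl
  let κ : C(X, ℝ) :=
    ⟨fun z => K.toFun z y, K.continuous.comp (by fun_prop : Continuous fun z => (z, y))⟩
  let b : C(X, ℝ) := ⟨fun z => ⟪K.reducedEval hl z, K.residualEval P hl y⟫_ℝ, by fun_prop⟩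
  let r (i : Fin k) : ℝ := K.comb (l i) y - proj f P (K.comb (l i)) y
  -- `z ↦ Π_P[K(z, ·)](y)` is identified with a continuous function, so that `Π_P` is additive on it.
  let s : C(X, ℝ) := κ - b - ∑ i, r i • f i
  have hs : (fun z => proj f P (K.toFun z) y) = s := by
    ext z
    simp only [s, b, κ, r, ContinuousMap.sub_apply, ContinuousMap.sum_apply,
      ContinuousMap.smul_apply, ContinuousMap.coe_mk, smul_eq_mul,
      inner_reducedEval_residualEval K hl hP, mul_comm (f _ z)]
    ring
  have hsx : proj f P (K.toFun x) y = s x := congrFun hs x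
  rw [inner_residualEval, residualKernel]
  change K.toFun x y - proj f P (K.toFun x) y - proj f P κ x +
    proj f P (fun z => proj f P (K.toFun z) y) x = b x - proj f P b x
  rw [hs, hsx]
  simp only [← projLinear_apply]
  simp only [s, map_sub, map_sum, map_smul, projLinear_feature f P hP,
    ContinuousMap.sub_apply, ContinuousMap.sum_apply, ContinuousMap.smul_apply, Pi.sub_apply,
    Finset.sum_apply, Pi.smul_apply]
  simp only [κ, ContinuousMap.coe_mk]
  ring

end CPDKernel

end Projection

end

/-! ### The native space and the residual kernel -/

theorem mainTheorem3 {d k : ℕ} (X : Set (EuclideanSpace ℝ (Fin d))) (hX : IsCompact X)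
    (f : Fin k → C(X, ℝ)) (hf : LinearIndependent ℝ f)
    (K : CPDKernel (featureSpan f))
    (P : Measure X) [IsProbabilityMeasure P] (hP : IsNondegenerate f P) :
    ∃ _ : Fact (opKernel (residualKernel f P K.toFun)).PosSemidef,
      (∃ ι : K.ReducedNative →L[ℝ] C(X, ℝ), K.IsNaturalEmbedding ι) ∧
      ∀ ι : K.ReducedNative →L[ℝ] C(X, ℝ), K.IsNaturalEmbedding ι →
        IsDirectSum (K.embFun ι) (featureSpan f) ∧
        IsDirectSum (rkhsFun (residualKernel f P K.toFun)) (featureSpan f) ∧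
        sumSpace (K.embFun ι) (featureSpan f) =
          sumSpace (rkhsFun (residualKernel f P K.toFun)) (featureSpan f) ∧
        (∀ g ∈ sumSpace (K.embFun ι) (featureSpan f),
          ∀ h ∈ sumSpace (K.embFun ι) (featureSpan f),
            semiInner (K.embFun ι) (featureSpan f) g h =
              semiInner (rkhsFun (residualKernel f P K.toFun)) (featureSpan f) g h) ∧
        (∀ (u : RKHS.OfKernel (opKernel (residualKernel f P K.toFun))),
          ∀ p ∈ featureSpan f,
            semiNorm (K.embFun ι) (featureSpan f)
              (rkhsFun (residualKernel f P K.toFun) u + p) = ‖u‖) := by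
  have : CompactSpace X := isCompact_iff_compactSpace.1 hX
  obtain ⟨l, hl⟩ := exists_dual_pointSum hf
  have hκ := K.residualKernel_eq_inner hl hP
  have hfact : Fact (opKernel (residualKernel f P K.toFun)).PosSemidef :=
    ⟨posSemidef_opKernel_of_inner hκ⟩
  refine ⟨hfact, ⟨_, K.isNaturalEmbedding_canonicalEmbedding hl⟩, fun ι hι => ?_⟩
  have hsub (h : K.ReducedNative) := hι.sub_mem (K.isNaturalEmbedding_canonicalEmbedding hl) h
  obtain ⟨U, hU⟩ := exists_isometryEquiv_rkhs hκ fun h => K.eq_zero_of_inner_residualEval hl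
  have hc := K.continuous_reducedEval hl
  -- With `ι₀` the canonical embedding, `w = (I - Π_P) (ι₀ (U w))`, so `w - ι (U w)` is
  -- `-Π_P (ι₀ (U w)) - (ι - ι₀) (U w)`, and both terms lie in the span of the `fᵢ`.
  have hmem (w) : rkhsFun (residualKernel f P K.toFun) w - K.embFun ι (U w) ∈ featureSpan f := by
    convert (featureSpan f).sub_mem ((featureSpan f).neg_mem (sum_mul_mem_featureSpan (f := f)
      (projCoeff f P fun z => ⟪K.reducedEval hl z, U w⟫_ℝ))) (hsub (U w)) using 1
    ext x
    simp only [Pi.sub_apply, Pi.neg_apply, hU, K.inner_residualEval hl]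
    rw [proj_eq_sum_projCoeff f P (by fun_prop)]
    change _ = _ - (_ - ⟪K.reducedEval hl x, U w⟫_ℝ)
    ring
  have hdirect : IsDirectSum (K.embFun ι) (featureSpan f) :=
    isDirectSum_of_forall fun h hh => K.eq_zero_of_inner_reducedEval_mem hl (by
      convert (featureSpan f).sub_mem hh (hsub h) using 1
      rw [sub_sub_cancel]
      rfl)
  have hsum := sumSpace_eq_of_isometryEquiv U hmem
  refine ⟨hdirect, hdirect.of_isometryEquiv U hmem, hsum.symm, fun g hg h hh => ?_,
    fun u p hp => ?_⟩
  · rw [← hsum] at hg hh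
    exact semiInner_isometryEquiv U hmem hdirect hg hh
  · have hq := (featureSpan f).add_mem (hmem u) hp
    rw [← U.norm_map u, ← hdirect.semiNorm_add (U u) hq]
    congr 1
    abel
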